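/- Let $d\ge 1$, $0\le t<n$, $1\le f\le N=d^n$ be integers. **Network.** Inputs and outputs of the $d$-ary inverse Banyan plane $\mathrm{BY}^{-1}(n)$ are the strings in $\mathbb Z_d^n$; its switching elements in each of the stages $1,\dots,n$ are labelled by $\mathbb Z_d^{n-1}$. Input $x$ is attached to element $x_{1..n-1}$ of stage $1$, output $y$ to element $y_{1..n-1}$ of stage $n$, and element $z$ of stage $i\le n-1$ is linked to the $d$ elements of stage $i+1$ that agree with $z$ except possibly in the $i$-th symbol. The unique path from $x$ to $y$ is denoted $R(x,y)$. The network $\log_d(N,0,m)$ consists of $m$ stacked copies (planes). A window is the set of the $d^t$ outputs with a given prefix of length $n-t$. An $f$-cast request is a pair $(a,B)$ with $a$ a free input and $B$ a set of at most $f$ free outputs. The window algorithm with window size $d^t$ routes, for each window $W$, the subrequest $(a,B\cap W)$ entirely on one plane; the routes of a new request must share no internal link with existing routes on the same plane. The network is $f$-cast wide-sense nonblocking under the window algorithm if, in every state reached by requests that are admitted according to this rule (in any admissible way) and by releases of connections, every $f$-cast request can be routed according to the rule without disturbing existing connections. **Dual linear program.** Let $a$ be an input, $W_0$ a window and $B\subseteq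 W_0$ with $|B|=k$, $1\le k\le \min(f,d^t)$. For $0\le i,j\le n-1$ let $A_i$ be the set of inputs $u\ne a$ such that the longest common suffix of $u_{1..n-1}$ and $a_{1..n-1}$ has length $i$, let $\mathcal A=\bigcup_i A_i$, and let $B_j$ be the set of outputs $v\notin B$ such that, for some $b\in B$, the longest common prefix of $v_{1..n-1}$ and $b_{1..n-1}$ has length $j$. For $u\in\mathcal A$ let $i(u)$ be the $i$ with $u\in A_i$; for a window $w\ne W_0$ let $j(w)$ be the $j$ with $w\subseteq B_j$; for $v\in W_0\setminus B$ let $j(v)$ be the largest $j$ with $v\in B_j$. The dual program (of the linear program bounding the number of planes that block $(a,B)$) is $$\min\ \sum_{w} d^t\alpha_w+\sum_{u,w}\beta_{u,w}+\sum_u\gamma_u+\sum_v\delta_v+\sum_u f\varepsilon_u$$ over $\alpha_w,\beta_{u,w},\gamma_u,\delta_v,\varepsilon_u\ge 0$ subject to $\alpha_w+\beta_{u,w}+\varepsilon_u\ge 1$ whenever $i(u)+j(w)\ge n$ and $\gamma_u+\delta_v+\varepsilon_u\ge 1$ whenever $i(u)+j(v)\ge n$, where $u\in\mathcal A$, $w$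 ranges over the windows other than $W_0$, $v\in W_0\setminus B$, and $\beta_{u,w}$ exists only if $i(u)+j(w)\ge n$. **The family.** For integers $0\le p\le n-t-1$ and $n-t\le q\le n$ let all variables be $0$ except for the following, which are $1$: - $\varepsilon_u$ if $i(u)\ge n-p$; - if $t\ge\lfloor n/2\rfloor$: $\beta_{u,w}$ if $p+1\le j(w)\le n-t-1$ and $n-j(w)\le i(u)\le n-p-1$; - if $p+1\le t\le\lfloor n/2\rfloor-1$: $\beta_{u,w}$ if $p+1\le j(w)\le t$ and $n-j(w)\le i(u)\le n-p-1$, and $\alpha_w$ if $t+1\le j(w)\le n-t-1$; - if $t\le p$ and $t<\lfloor n/2\rfloor$: $\alpha_w$ if $p+1\le j(w)\le n-t-1$; - $\delta_v$ if $v\in\bigcup_{j=q}^{n-1}B_j$; - if $q>n-t$: $\gamma_u$ if $n-q+1\le i(u)\le n-p-1$. **The cost.** Put $\mu=\min\{d^t-k,\ k(d^{n-q}-1)\}$ and define $c(k,p,q)=f(d^p-1)+c_1+c_2$, where $$c_1=\begin{cases}(n-t-1-p)(d^{n-t}-d^{n-t-1})-d^{n-t-1}+d^p & t\ge\lfloor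 n/2\rfloor,\\ (t-p)(d^{n-t}-d^{n-t-1})+d^{n+p-2t-1}-d^t & p+1\le t\le\lfloor n/2\rfloor-1,\\ d^{n-p-1}-d^t & t\le p,\end{cases}\qquad c_2=\begin{cases}d^t-k & q=n-t,\\ d^{q-1}-d^p+\mu & q>n-t\end{cases}$$ (if the first and the third case of $c_1$ both apply, they agree). **Theorem.** 1. For all $a,W_0,B$ as above and all $p,q$ in the stated ranges, the solution with parameters $(p,q)$ is feasible for the dual program, and its objective value is at most $c(k,p,q)$, with equality if $q=n-t$. For all $a$, $W_0$, all $k$ with $1\le k\le\min(f,d^t)$ and all $q$ there is $B\subseteq W_0$ with $|B|=k$ for which the objective value equals $c(k,p,q)$ for every $p$; that is, $c(k,p,q)$ is the worst-case objective value over all $B$ of size $k$. 2. Consequently, $\log_d(N,0,m)$ is $f$-cast wide-sense nonblocking under the window algorithm with window size $d^t$ whenever $$m\ \ge\ 1+\max_{1\le k\le\min(f,d^t)}\ \min_{\substack{0\le p\le n-t-1\\ n-t\le q\le n}}c(k,p,q).$$ -/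

import Mathlib

namespace Multilog

/-! ### Strings -/

/-- `d`-ary strings of length `l`; inputs and outputs of the `d^n × d^n` network are the strings
of length `n`. Symbol number `i` (counted from `1` in the text) is `s (i - 1)`. -/
abbrev Str (d l : ℕ) : Type := Fin l → Fin d

/-- The substring `s_{1..n-1}`. -/
def trunc {d n : ℕ} (s : Str d n) : Str d (n - 1) := fun i => s (Fin.castLE (Nat.sub_le n 1) i)

/-- Length of the longest common prefix. -/
def pre {d l : ℕ} (u v : Str d l) : ℕ :=
  Nat.findGreatest (fun j => ∀ i : Fin l, i.val < j → u i = v i) l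

/-- Length of the longest common suffix. -/
def suf {d l : ℕ} (u v : Str d l) : ℕ :=
  Nat.findGreatest (fun j => ∀ i : Fin l, l - j ≤ i.val → u i = v i) l

/-! ### The inverse Banyan plane

There are `n` stages of switching elements, numbered `0, …, n - 1` here; those of each stage are
labelled by the strings of length `n - 1`. -/

/-- The switching element `z` of stage `j` is linked to `z'` of stage `j + 1`
iff the two labels agree except possibly in the symbol with index `j`. -/
def Linked {d n : ℕ} (j : Fin (n - 1)) (z z' : Str d (n - 1)) : Prop :=
  ∀ l : Fin (n - 1), l ≠ j → z l = z' l

/-- `s 0, …, s (n - 1)` are the switching elements, stage by stage,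
of a path of the plane from input `x` to output `y`. -/
def IsPath {d n : ℕ} (x y : Str d n) (s : ℕ → Str d (n - 1)) : Prop :=
  s 0 = trunc x ∧ s (n - 1) = trunc y ∧ ∀ j : Fin (n - 1), Linked j (s j.val) (s (j.val + 1))

/-- The switching element at stage `j` of the path from `x` to `y`: `y_1 ⋯ y_j x_{j+1} ⋯ x_{n-1}`. -/
def node {d n : ℕ} (x y : Str d n) (j : ℕ) : Str d (n - 1) :=
  fun l => if l.val < j then trunc y l else trunc x l

theorem isPath_node {d n : ℕ} (x y : Str d n) : IsPath x y (node x y) := by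
  refine ⟨?_, ?_, ?_⟩
  · funext l; simp [node]
  · funext l; simp [node, l.isLt]
  · intro j l hl
    have h : l.val ≠ j.val := fun h => hl (Fin.ext h)
    have h2 : (l.val < j.val) ↔ (l.val < j.val + 1) := by omega
    simp [node, h2]

/-- The path from `x` to `y` is unique. -/
theorem IsPath.eq_node {d n : ℕ} {x y : Str d n} {s : ℕ → Str d (n - 1)} (h : IsPath x y s)
    (j : ℕ) (hj : j ≤ n - 1) : s j = node x y j := by
  obtain ⟨h0, h1, h2⟩ := h
  funext l
  by_cases hl : l.val < j
  · have key : ∀ k, j + k ≤ n - 1 → s (j + k) l = s j l := by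
      intro k
      induction k with
      | zero => intro _; rfl
      | succ k ih =>
        intro hk
        have := h2 ⟨j + k, by omega⟩ l (by intro e; simp [Fin.ext_iff] at e; omega)
        rw [← ih (by omega)]
        exact this.symm
    have := key (n - 1 - j) (by omega)
    rw [Nat.add_sub_cancel' hj, h1] at this
    simp [node, hl, this]
  · have key : ∀ k, k ≤ l.val → s k l = s 0 l := by
      intro k
      induction k with
      | zero => intro _; rfl
      | succ k ih =>
        intro hk
        have := h2 ⟨k, by omega⟩ l (by intro e; simp [Fin.ext_iff] at e; omega)
        rw [← ih (by omega)]
        exact this.symm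
    have := key j (by omega)
    rw [h0] at this
    simp [node, hl, this]

/-- The internal link used between the stages `j` and `j + 1` by the route `R(x, y)`,
given by `j` and its two end nodes. -/
def routeLink {d n : ℕ} (x y : Str d n) (j : Fin (n - 1)) :
    Fin (n - 1) × Str d (n - 1) × Str d (n - 1) :=
  (j, node x y j.val, node x y (j.val + 1))

/-- On one plane, the routes `R(x, y)` and `R(u, v)` share an internal link. -/
def SharesLink {d n : ℕ} (x y u v : Str d n) : Prop :=
  ∃ j j' : Fin (n - 1), routeLink x y j = routeLink u v j'

/-! ### The multilog network with `m` planes and the window algorithm -/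

/-- The window (of size `d^t`) of an output, labelled by the common prefix of length `n - t`
of its members. -/
def window {d n : ℕ} (t : ℕ) (v : Str d n) : Str d (n - t) :=
  fun i => v (Fin.castLE (Nat.sub_le n t) i)

/-- A routed multicast connection: its outputs, and for each of them the plane that carries the
branch to it (`plane b` is irrelevant for `b ∉ dests`). -/
structure Connection (d n m : ℕ) where
  dests : Finset (Str d n)
  plane : Str d n → Fin m

/-- A state of the network: the current connection of each input, if any. -/
abbrev State (d n m : ℕ) : Type := Str d n → Option (Connection d n m)

/-- `(a, B)` is an `f`-cast request in state `s`: `a` is a free input and `B` is a set of at most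
`f` free outputs. -/
def IsRequest {d n m : ℕ} (f : ℕ) (s : State d n m) (a : Str d n) (B : Finset (Str d n)) : Prop :=
  s a = none ∧ B.card ≤ f ∧ ∀ u c, s u = some c → Disjoint c.dests B

/-- The rule of the window algorithm: the part of the request in one window is routed entirely on
one plane. -/
def FollowsWindowRule {d n m : ℕ} (t : ℕ) (c : Connection d n m) : Prop :=
  ∀ b ∈ c.dests, ∀ b' ∈ c.dests, window t b = window t b' → c.plane b = c.plane b'

/-- The routes of the new connection `c` from input `a` share no internal link with a route that
exists in state `s`. -/
def Unblocked {d n m : ℕ} (s : State d n m) (a : Str d n) (c : Connection d n m) : Prop :=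
  ∀ u c', s u = some c' → ∀ v ∈ c'.dests, ∀ b ∈ c.dests,
    c'.plane v = c.plane b → ¬ SharesLink u v a b

/-- The states that can arise when `f`-cast requests come and go in any order and each of them is
routed in any way that the window algorithm with window size `d^t` permits. -/
inductive Reachable {d n m : ℕ} (f t : ℕ) : State d n m → Prop
  | idle : Reachable f t (fun _ => none)
  | connect (s : State d n m) (a : Str d n) (c : Connection d n m) :
      Reachable f t s → IsRequest f s a c.dests → FollowsWindowRule t c → Unblocked s a c →
      Reachable f t (Function.update s a (some c))
  | release (s : State d n m) (a : Str d n) :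
      Reachable f t s → Reachable f t (Function.update s a none)

/-- `log_d(d^n, 0, m)` is `f`-cast wide-sense nonblocking under the window algorithm with window
size `d^t`: whatever the history, each new request can be routed by the algorithm without
disturbing the existing connections. -/
def WideSenseNonblocking (d n m f t : ℕ) : Prop :=
  ∀ s : State d n m, Reachable f t s → ∀ (a : Str d n) (B : Finset (Str d n)),
    IsRequest f s a B →
      ∃ c : Connection d n m, c.dests = B ∧ FollowsWindowRule t c ∧ Unblocked s a c

/-! ### The dual linear program

`a` is the input of the new request, `B` the set of its outputs,
which all lie in the window labelled `w₀`. -/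

/-- The set of all outputs in the window labelled `w`. -/
def windowSet {d n : ℕ} (t : ℕ) (w : Str d (n - t)) : Finset (Str d n) :=
  Finset.univ.filter fun v => window t v = w

/-- The set `A_i`. -/
def setA {d n : ℕ} (a : Str d n) (i : ℕ) : Finset (Str d n) :=
  Finset.univ.filter fun u => u ≠ a ∧ suf (trunc u) (trunc a) = i

/-- The set `𝒜`, the union of `A_0, …, A_{n-1}`. -/
def allA {d n : ℕ} (a : Str d n) : Finset (Str d n) :=
  (Finset.range n).biUnion (setA a)

/-- The set `B_j`. -/
def setB {d n : ℕ} (B : Finset (Str d n)) (j : ℕ) : Finset (Str d n) :=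
  Finset.univ.filter fun v => v ∉ B ∧ ∃ b ∈ B, pre (trunc v) (trunc b) = j

/-- The index `i(u)`, for `u ∈ 𝒜`: the `i` with `u ∈ A_i`. -/
def idxI {d n : ℕ} (a u : Str d n) : ℕ := suf (trunc u) (trunc a)

/-- The index `j(w)` of a window other than that of `B`: the (only) `j ≤ n - 1` such that the
window is contained in `B_j`. -/
def idxW {d n : ℕ} (t : ℕ) (B : Finset (Str d n)) (w : Str d (n - t)) : ℕ :=
  Nat.findGreatest (fun j => windowSet t w ⊆ setB B j) (n - 1)

/-- The index `j(v)` of an output in the window of `B` but not in `B`: the largest `j ≤ n - 1`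
with `v ∈ B_j`. -/
def idxV {d n : ℕ} (B : Finset (Str d n)) (v : Str d n) : ℕ :=
  Nat.findGreatest (fun j => v ∈ setB B j) (n - 1)

/-- The pairs `(u, w)` for which the primal variable `x_{u,w}` is defined. -/
def pairsUW {d n : ℕ} (t : ℕ) (a : Str d n) (w₀ : Str d (n - t)) (B : Finset (Str d n)) :
    Finset (Str d n × Str d (n - t)) :=
  (allA a ×ˢ Finset.univ.erase w₀).filter fun x => n ≤ idxI a x.1 + idxW t B x.2

/-- The pairs `(u, v)` for which the primal variable `x_{u,v}` is defined. -/
def pairsUV {d n : ℕ} (t : ℕ) (a : Str d n) (w₀ : Str d (n - t)) (B : Finset (Str d n)) :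
    Finset (Str d n × Str d n) :=
  (allA a ×ˢ (windowSet t w₀ \ B)).filter fun x => n ≤ idxI a x.1 + idxV B x.2

/-- An assignment of values to the dual variables. Only `α w` with `w ≠ w₀`, `β u w` with
`(u, w) ∈ pairsUW`, `γ u` and `ε u` with `u ∈ 𝒜`, and `δ v` with `v` in the window `w₀` but not in
`B` belong to the program; other values play no role. -/
structure DualVars (d n t : ℕ) where
  α : Str d (n - t) → ℝ
  β : Str d n → Str d (n - t) → ℝ
  γ : Str d n → ℝ
  δ : Str d n → ℝ
  ε : Str d n → ℝ

/-- The objective function of the dual program. -/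
def dualObjective {d n t : ℕ} (f : ℕ) (a : Str d n) (w₀ : Str d (n - t)) (B : Finset (Str d n))
    (y : DualVars d n t) : ℝ :=
  (∑ w ∈ Finset.univ.erase w₀, (d : ℝ) ^ t * y.α w) + (∑ x ∈ pairsUW t a w₀ B, y.β x.1 x.2)
    + (∑ u ∈ allA a, y.γ u) + (∑ v ∈ windowSet t w₀ \ B, y.δ v) + ∑ u ∈ allA a, (f : ℝ) * y.ε u

/-- The constraints of the dual program. -/
structure DualFeasible {d n t : ℕ} (a : Str d n) (w₀ : Str d (n - t)) (B : Finset (Str d n))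
    (y : DualVars d n t) : Prop where
  dc1 : ∀ x ∈ pairsUW t a w₀ B, 1 ≤ y.α x.2 + y.β x.1 x.2 + y.ε x.1
  dc2 : ∀ x ∈ pairsUV t a w₀ B, 1 ≤ y.γ x.1 + y.δ x.2 + y.ε x.1
  α_nonneg : ∀ w, w ≠ w₀ → 0 ≤ y.α w
  β_nonneg : ∀ x ∈ pairsUW t a w₀ B, 0 ≤ y.β x.1 x.2
  γ_nonneg : ∀ u ∈ allA a, 0 ≤ y.γ u
  δ_nonneg : ∀ v ∈ windowSet t w₀ \ B, 0 ≤ y.δ v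
  ε_nonneg : ∀ u ∈ allA a, 0 ≤ y.ε u

/-- The two-parameter family of dual solutions, `0 ≤ p ≤ n - t - 1` and `n - t ≤ q ≤ n`. -/
def dualFamily {d n : ℕ} (t : ℕ) (a : Str d n) (B : Finset (Str d n)) (p q : ℕ) :
    DualVars d n t where
  α := fun w =>
    if n / 2 ≤ t then 0
    else if p + 1 ≤ t then
      if t + 1 ≤ idxW t B w ∧ idxW t B w ≤ n - t - 1 then 1 else 0
    else
      if p + 1 ≤ idxW t B w ∧ idxW t B w ≤ n - t - 1 then 1 else 0
  β := fun u w =>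
    if n / 2 ≤ t then
      if (p + 1 ≤ idxW t B w ∧ idxW t B w ≤ n - t - 1) ∧
        (n - idxW t B w ≤ idxI a u ∧ idxI a u ≤ n - p - 1) then 1 else 0
    else if p + 1 ≤ t then
      if (p + 1 ≤ idxW t B w ∧ idxW t B w ≤ t) ∧
        (n - idxW t B w ≤ idxI a u ∧ idxI a u ≤ n - p - 1) then 1 else 0
    else 0
  γ := fun u =>
    if q = n - t then 0
    else if n - q + 1 ≤ idxI a u ∧ idxI a u ≤ n - p - 1 then 1 else 0
  δ := fun v => if v ∈ (Finset.Ico q n).biUnion (setB B) then 1 else 0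
  ε := fun u => if n - p ≤ idxI a u then 1 else 0

/-! ### The cost -/

/-- The quantity `c(k, p, q)`. For `n` odd, `t = (n - 1) / 2` and `p = t` the first and the third
case both apply, and agree. -/
def cost (d n t f k p q : ℕ) : ℤ :=
  if n / 2 ≤ t then
    if q = n - t then
      f * (d ^ p - 1) + ((n - t - 1 - p : ℕ) : ℤ) * (d ^ (n - t) - d ^ (n - t - 1))
        - d ^ (n - t - 1) + d ^ p + d ^ t - k
    else
      f * (d ^ p - 1) + ((n - t - 1 - p : ℕ) : ℤ) * (d ^ (n - t) - d ^ (n - t - 1))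
        - d ^ (n - t - 1) + d ^ (q - 1) + min ((d : ℤ) ^ t - k) (k * (d ^ (n - q) - 1))
  else if p + 1 ≤ t then
    if q = n - t then
      f * (d ^ p - 1) + ((t - p : ℕ) : ℤ) * (d ^ (n - t) - d ^ (n - t - 1))
        + d ^ (n + p - 2 * t - 1) - k
    else
      f * (d ^ p - 1) + ((t - p : ℕ) : ℤ) * (d ^ (n - t) - d ^ (n - t - 1))
        + d ^ (n + p - 2 * t - 1) - d ^ t + d ^ (q - 1) - d ^ p
        + min ((d : ℤ) ^ t - k) (k * (d ^ (n - q) - 1))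
  else
    if q = n - t then
      f * (d ^ p - 1) + d ^ (n - p - 1) - k
    else
      f * (d ^ p - 1) + d ^ (n - p - 1) - d ^ t + d ^ (q - 1) - d ^ p
        + min ((d : ℤ) ^ t - k) (k * (d ^ (n - q) - 1))

/-- The minimum of `c(k, p, q)` over `0 ≤ p ≤ n - t - 1` and `n - t ≤ q ≤ n`. -/
def minCost (d n t f k : ℕ) : ℤ :=
  (Finset.Icc 0 (n - t - 1) ×ˢ Finset.Icc (n - t) n).inf'
    (Finset.Nonempty.product (Finset.nonempty_Icc.2 (Nat.zero_le _))
      (Finset.nonempty_Icc.2 (Nat.sub_le n t)))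
    fun x => cost d n t f k x.1 x.2

/-- The maximum of `min_{p,q} c(k, p, q)` over `1 ≤ k ≤ min(f, d^t)`. -/
def maxMinCost (d n t f : ℕ) (hd : 1 ≤ d) (hf : 1 ≤ f) : ℤ :=
  (Finset.Icc 1 (min f (d ^ t))).sup'
    (Finset.nonempty_Icc.2 (le_min hf (Nat.one_le_pow t d hd)))
    (minCost d n t f)

end Multilog

namespace Multilog

variable {d n t : ℕ}

/-! ### Common prefixes and suffixes -/

/-! The bound on the number of planes is weak duality. If `R(u,v)` shares the link after stage `j`
with `R(a,b)`, its first end node forces a common suffix of `u` and `a` and its second a common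
prefix of `v` and `b`, of total length at least `n` (`SharesLink.le_add`). Suppose that every plane
is blocked for a subrequest inside one window, and choose one blocking route `R(u P, v P)` on each
plane `P`. The outputs `v P` are distinct, an input occurs at most `f` times, and a pair (input,
window) at most once, because a connection serves each window on a single plane. So the choice is a
feasible point of the primal program, and its size `m` is at most every dual objective value
(`card_le_dualObjective`, `exists_not_blocks`). Since the branches of one request need not avoid
each other, the windows of a request can be treated independently.

It remains to evaluate the dual family. The `α`, `β`, `γ`, `ε` parts count strings with a prescribed
common prefix or suffix length, so they do not depend on `B`. The `δ` part counts the outputs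
outside `B` that share `q` symbols with a member of `B`; it equals `d^(n-q) * r - k`, where `r` is
the number of windows of size `d^(n-q)` that meet `B` (`sum_delta`). As `r ≤ min k (d^(q-(n-t)))`,
with equality when `B` is spread out as evenly as possible, the worst case is `μ` (`cost_eq`,
`exists_card_image_window_eq`). -/

theorem le_pre_iff {l : ℕ} (u v : Str d l) {j : ℕ} (hj : j ≤ l) :
    j ≤ pre u v ↔ ∀ i : Fin l, i.val < j → u i = v i := by
  constructor
  · intro h i hi
    have hs : (fun j => ∀ i : Fin l, i.val < j → u i = v i) (pre u v) :=
      Nat.findGreatest_spec (m := 0) (P := fun j => ∀ i : Fin l, i.val < j → u i = v i)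
        (Nat.zero_le l) (fun i hi => absurd hi (Nat.not_lt_zero _))
    exact hs i (hi.trans_le h)
  · intro h
    exact Nat.le_findGreatest hj h

theorem le_suf_iff {l : ℕ} (u v : Str d l) {j : ℕ} (hj : j ≤ l) :
    j ≤ suf u v ↔ ∀ i : Fin l, l - j ≤ i.val → u i = v i := by
  constructor
  · intro h i hi
    have hs : (fun j => ∀ i : Fin l, l - j ≤ i.val → u i = v i) (suf u v) :=
      Nat.findGreatest_spec (m := 0) (P := fun j => ∀ i : Fin l, l - j ≤ i.val → u i = v i)
        (Nat.zero_le l) (fun i hi => absurd i.isLt (by omega))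
    exact hs i (by omega)
  · intro h
    exact Nat.le_findGreatest hj h

theorem pre_le {l : ℕ} (u v : Str d l) : pre u v ≤ l := Nat.findGreatest_le _

theorem suf_le {l : ℕ} (u v : Str d l) : suf u v ≤ l := Nat.findGreatest_le _

theorem pre_lt {l : ℕ} {u v : Str d l} (h : u ≠ v) : pre u v < l := by
  by_contra hl
  exact h (funext fun i => (le_pre_iff u v le_rfl).1 (not_lt.1 hl) i i.isLt)

theorem le_pre_trunc_iff (v b : Str d n) {j : ℕ} (hj : j ≤ n - 1) :
    j ≤ pre (trunc v) (trunc b) ↔ ∀ i : Fin n, i.val < j → v i = b i := by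
  rw [le_pre_iff _ _ hj]
  constructor
  · intro h i hi
    exact h ⟨i, by omega⟩ hi
  · intro h i hi
    exact h _ hi

theorem le_idxI_iff (a u : Str d n) {j : ℕ} (hj : j ≤ n - 1) :
    j ≤ idxI a u ↔ ∀ i : Fin n, n - 1 - j ≤ i.val → i.val < n - 1 → u i = a i := by
  rw [idxI, le_suf_iff _ _ hj]
  constructor
  · intro h i hi hi'
    exact h ⟨i, hi'⟩ hi
  · intro h i hi
    exact h _ hi i.isLt

theorem window_eq_iff (v b : Str d n) :
    window t v = window t b ↔ ∀ i : Fin n, i.val < n - t → v i = b i := by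
  constructor
  · intro h i hi
    exact congrFun h ⟨i, hi⟩
  · intro h
    funext i
    exact h _ i.isLt

theorem le_pre_window_iff (v b : Str d n) {j : ℕ} (hj : j ≤ n - t) :
    j ≤ pre (window t v) (window t b) ↔ ∀ i : Fin n, i.val < j → v i = b i := by
  rw [le_pre_iff _ _ hj]
  constructor
  · intro h i hi
    exact h ⟨i, by omega⟩ hi
  · intro h i hi
    exact h _ hi

theorem window_surjective (hd : 1 ≤ d) (w : Str d (n - t)) : ∃ v : Str d n, window t v = w :=
  ⟨fun i => if h : i.val < n - t then w ⟨i, h⟩ else ⟨0, hd⟩, by funext i; simp [window]⟩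

theorem mem_windowSet {w : Str d (n - t)} {v : Str d n} : v ∈ windowSet t w ↔ window t v = w := by
  simp [windowSet]

theorem mem_setB {B : Finset (Str d n)} {j : ℕ} {v : Str d n} :
    v ∈ setB B j ↔ v ∉ B ∧ ∃ b ∈ B, pre (trunc v) (trunc b) = j := by
  simp [setB]

theorem mem_allA (hn : 1 ≤ n) {a u : Str d n} : u ∈ allA a ↔ u ≠ a := by
  have := suf_le (trunc u) (trunc a)
  simp only [allA, setA, Finset.mem_biUnion, Finset.mem_range, Finset.mem_filter,
    Finset.mem_univ, true_and]
  constructor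
  · rintro ⟨_, _, h, _⟩
    exact h
  · intro h
    exact ⟨_, by omega, h, rfl⟩

/-- For outputs in different windows the window of one determines the common prefix. -/
theorem pre_trunc_eq_pre_window (ht : t < n) {v b : Str d n} (h : window t v ≠ window t b) :
    pre (trunc v) (trunc b) = pre (window t v) (window t b) := by
  have h1 := pre_lt h
  apply le_antisymm
  · have h2 := pre_le (trunc v) (trunc b)
    have h3 := (le_pre_trunc_iff v b h2).1 le_rfl
    by_contra hlt
    have h4 : pre (window t v) (window t b) + 1 ≤ pre (window t v) (window t b) :=
      (le_pre_window_iff v b (by omega)).2 fun i hi => h3 i (by omega)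
    omega
  · rw [le_pre_trunc_iff v b (by omega)]
    exact (le_pre_window_iff v b h1.le).1 le_rfl

/-- A window other than `w₀` differs from `w₀` within the first `n - t` symbols, so all its outputs
have the same common prefix length with all members of `B`. Hence the index depends on `w₀` only,
not on `B`. -/
theorem idxW_eq (hd : 1 ≤ d) (ht : t < n) {w₀ w : Str d (n - t)} {B : Finset (Str d n)}
    (hB : B.Nonempty) (hBw : B ⊆ windowSet t w₀) (hw : w ≠ w₀) : idxW t B w = pre w w₀ := by
  have hpre : ∀ v ∈ windowSet t w, ∀ b ∈ B, v ∉ B ∧ pre (trunc v) (trunc b) = pre w w₀ := by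
    intro v hv b hb
    have hv' := mem_windowSet.1 hv
    have hb' := mem_windowSet.1 (hBw hb)
    refine ⟨fun h => hw ?_, ?_⟩
    · rw [← hv', mem_windowSet.1 (hBw h)]
    · rw [pre_trunc_eq_pre_window ht (by rw [hv', hb']; exact hw), hv', hb']
  have hlt := pre_lt hw
  obtain ⟨b, hb⟩ := hB
  obtain ⟨v, hv⟩ := window_surjective hd w
  have key : windowSet t w ⊆ setB B (pre w w₀) := fun v hv =>
    mem_setB.2 ⟨(hpre v hv b hb).1, b, hb, (hpre v hv b hb).2⟩
  apply le_antisymm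
  · have hs : (fun j => windowSet t w ⊆ setB B j) (idxW t B w) :=
      Nat.findGreatest_spec (P := fun j => windowSet t w ⊆ setB B j) (m := pre w w₀)
        (by omega) key
    obtain ⟨_, b', hb', h⟩ := mem_setB.1 (hs (mem_windowSet.2 hv))
    rw [← h, (hpre v (mem_windowSet.2 hv) b' hb').2]
  · exact Nat.le_findGreatest (by omega) key

theorem idxW_lt (hd : 1 ≤ d) (ht : t < n) {w₀ w : Str d (n - t)} {B : Finset (Str d n)}
    (hB : B.Nonempty) (hBw : B ⊆ windowSet t w₀) (hw : w ≠ w₀) : idxW t B w < n - t := by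
  rw [idxW_eq hd ht hB hBw hw]
  exact pre_lt hw

theorem pre_trunc_le_idxV {B : Finset (Str d n)} {v b : Str d n} (hv : v ∉ B) (hb : b ∈ B) :
    pre (trunc v) (trunc b) ≤ idxV B v :=
  Nat.le_findGreatest (pre_le _ _) (mem_setB.2 ⟨hv, b, hb, rfl⟩)

theorem mem_setB_idxV {B : Finset (Str d n)} {v : Str d n} (hB : B.Nonempty) (hv : v ∉ B) :
    v ∈ setB B (idxV B v) := by
  obtain ⟨b, hb⟩ := hB
  exact Nat.findGreatest_spec (P := fun j => v ∈ setB B j) (pre_le _ _)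
    (mem_setB.2 ⟨hv, b, hb, rfl⟩)

theorem sub_le_idxV {w₀ : Str d (n - t)} {B : Finset (Str d n)} (hB : B.Nonempty)
    (hBw : B ⊆ windowSet t w₀) {v : Str d n} (hv : v ∈ windowSet t w₀ \ B) :
    n - t ≤ idxV B v := by
  rw [Finset.mem_sdiff, mem_windowSet] at hv
  obtain ⟨b, hb⟩ := hB
  have hvb : window t v = window t b := by rw [hv.1, mem_windowSet.1 (hBw hb)]
  have hagree := (window_eq_iff v b).1 hvb
  -- This fails only for `t = 0`, when windows are single outputs and `v` would be `b`.
  have ht : n - t ≤ n - 1 := by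
    by_contra h
    refine hv.2 ?_
    have : v = b := funext fun i => hagree i (by omega)
    rwa [this]
  exact ((le_pre_trunc_iff v b ht).2 hagree).trans (pre_trunc_le_idxV hv.2 hb)

/-! ### Counting -/

/-- The set is a product: a singleton at each index in `[lo, hi)`, the whole alphabet elsewhere. -/
theorem card_agree {l : ℕ} (a : Str d l) (lo hi : ℕ) (h : hi ≤ l) :
    (Finset.univ.filter fun s : Str d l =>
      ∀ i : Fin l, lo ≤ i.val → i.val < hi → s i = a i).card = d ^ (l - (hi - lo)) := by
  have h1 : (Finset.univ.filter fun s : Str d l =>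
      ∀ i : Fin l, lo ≤ i.val → i.val < hi → s i = a i) =
      Fintype.piFinset fun i : Fin l =>
        if lo ≤ i.val ∧ i.val < hi then {a i} else (Finset.univ : Finset (Fin d)) := by
    ext s
    simp only [Finset.mem_filter, Finset.mem_univ, true_and, Fintype.mem_piFinset]
    refine forall_congr' fun i => ?_
    split_ifs with hi'
    · simp [hi']
    · simpa using fun h1 h2 => absurd ⟨h1, h2⟩ hi'
  have h2 : ((Finset.univ : Finset (Fin l)).filter fun i => lo ≤ i.val ∧ i.val < hi).card
      = hi - lo := by
    rw [← Nat.card_Ico, ← Finset.card_map Fin.valEmbedding]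
    congr 1
    ext i
    simp only [Finset.mem_map, Finset.mem_filter, Finset.mem_univ, true_and, Finset.mem_Ico,
      Fin.valEmbedding_apply]
    constructor
    · rintro ⟨j, hj, rfl⟩
      exact hj
    · intro hi'
      exact ⟨⟨i, by omega⟩, hi', rfl⟩
  have h3 := Finset.card_filter_add_card_filter_not (s := (Finset.univ : Finset (Fin l)))
    (fun i => lo ≤ i.val ∧ i.val < hi)
  rw [h2, Finset.card_univ, Fintype.card_fin] at h3
  rw [h1, Fintype.card_piFinset]
  simp only [apply_ite Finset.card, Finset.card_singleton, Finset.card_univ, Fintype.card_fin]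
  rw [Finset.prod_ite, Finset.prod_const_one, one_mul, Finset.prod_const]
  congr 1
  omega

theorem card_windowSet (hd : 1 ≤ d) (ht : t ≤ n) (w : Str d (n - t)) :
    (windowSet t w).card = d ^ t := by
  obtain ⟨v, rfl⟩ := window_surjective hd w
  have h := card_agree v 0 (n - t) (Nat.sub_le n t)
  rw [Nat.sub_zero, Nat.sub_sub_self ht] at h
  rw [← h, windowSet]
  congr 1
  ext s
  simp [window_eq_iff]

/-- The disjunct `u = a` matters only for `i = n`, a length that no truncated string reaches; it
keeps the formula uniform. For `i < n`, `i` symbols are fixed and the last symbol is free. -/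
theorem card_le_idxI (hn : 1 ≤ n) (a : Str d n) {i : ℕ} (hi : i ≤ n) :
    (Finset.univ.filter fun u : Str d n => u = a ∨ i ≤ idxI a u).card = d ^ (n - i) := by
  rcases hi.eq_or_lt with hin | hi
  · rw [Finset.card_eq_one.2 ⟨a, ?_⟩, hin, Nat.sub_self, pow_zero]
    ext u
    have hs : idxI a u ≤ n - 1 := suf_le _ _
    have h : ¬ i ≤ idxI a u := by omega
    simp [h]
  · have h := card_agree a (n - 1 - i) (n - 1) (Nat.sub_le n 1)
    rw [show n - 1 - (n - 1 - i) = i by omega] at h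
    rw [← h]
    congr 1
    ext u
    simp only [Finset.mem_filter, Finset.mem_univ, true_and, ← le_idxI_iff a u (Nat.le_sub_one_of_lt hi)]
    refine or_iff_right_of_imp ?_
    rintro rfl
    exact (le_idxI_iff u u (Nat.le_sub_one_of_lt hi)).2 fun _ _ _ => rfl

/-- A difference of two nested sets of the previous kind; `a` lies in both and cancels. -/
theorem card_idxI_between (hn : 1 ≤ n) (a : Str d n) {lo hi : ℕ} (hlo : lo ≤ hi) (hhi : hi ≤ n) :
    (((allA a).filter fun u => lo ≤ idxI a u ∧ idxI a u < hi).card : ℝ)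
      = (d : ℝ) ^ (n - lo) - (d : ℝ) ^ (n - hi) := by
  have hsub : (Finset.univ.filter fun u : Str d n => u = a ∨ hi ≤ idxI a u) ⊆
      Finset.univ.filter fun u : Str d n => u = a ∨ lo ≤ idxI a u := by
    intro u
    simp only [Finset.mem_filter, Finset.mem_univ, true_and]
    exact Or.imp_right hlo.trans
  have heq : ((allA a).filter fun u => lo ≤ idxI a u ∧ idxI a u < hi) =
      (Finset.univ.filter fun u : Str d n => u = a ∨ lo ≤ idxI a u) \
        Finset.univ.filter fun u : Str d n => u = a ∨ hi ≤ idxI a u := by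
    ext u
    simp only [Finset.mem_filter, Finset.mem_univ, true_and, Finset.mem_sdiff, mem_allA hn]
    by_cases hu : u = a
    · simp [hu]
    · simp [hu]
  rw [heq, Finset.cast_card_sdiff hsub, card_le_idxI hn a hhi, card_le_idxI hn a (hlo.trans hhi)]
  push_cast
  rfl

theorem card_idxW_between (hd : 1 ≤ d) (ht : t < n) {w₀ : Str d (n - t)} {B : Finset (Str d n)}
    (hB : B.Nonempty) (hBw : B ⊆ windowSet t w₀) {lo hi : ℕ} (hlo : lo ≤ hi) (hhi : hi ≤ n - t) :
    (((Finset.univ.erase w₀).filter fun w => lo ≤ idxW t B w ∧ idxW t B w < hi).card : ℝ)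
      = (d : ℝ) ^ (n - t - lo) - (d : ℝ) ^ (n - t - hi) := by
  have hcard : ∀ j ≤ n - t, (Finset.univ.filter fun w : Str d (n - t) => j ≤ pre w w₀).card
      = d ^ (n - t - j) := by
    intro j hj
    have h := card_agree w₀ 0 j hj
    rw [Nat.sub_zero] at h
    rw [← h]
    congr 1
    ext w
    simp [le_pre_iff w w₀ hj]
  have hsub : (Finset.univ.filter fun w : Str d (n - t) => hi ≤ pre w w₀) ⊆
      Finset.univ.filter fun w : Str d (n - t) => lo ≤ pre w w₀ := by
    intro w
    simp only [Finset.mem_filter, Finset.mem_univ, true_and]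
    exact hlo.trans
  have heq : ((Finset.univ.erase w₀).filter fun w => lo ≤ idxW t B w ∧ idxW t B w < hi) =
      (Finset.univ.filter fun w : Str d (n - t) => lo ≤ pre w w₀) \
        Finset.univ.filter fun w : Str d (n - t) => hi ≤ pre w w₀ := by
    ext w
    simp only [Finset.mem_filter, Finset.mem_univ, true_and, Finset.mem_sdiff, Finset.mem_erase,
      and_true, not_le]
    by_cases hw : w = w₀
    · subst hw
      simp only [ne_eq, not_true_eq_false, false_and, false_iff, not_and, not_lt]
      intro _
      exact (le_pre_iff w w hhi).2 fun _ _ => rfl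
    · simp [hw, idxW_eq hd ht hB hBw hw]
  rw [heq, Finset.cast_card_sdiff hsub, hcard _ hhi, hcard _ (hlo.trans hhi)]
  push_cast
  rfl

/-! ### The objective value of the family -/

theorem sum_idxI_between (hn : 1 ≤ n) (a : Str d n) {lo hi : ℕ} (hlo : lo ≤ hi + 1)
    (hhi : hi + 1 ≤ n) :
    (∑ u ∈ allA a, if lo ≤ idxI a u ∧ idxI a u ≤ hi then (1 : ℝ) else 0)
      = (d : ℝ) ^ (n - lo) - (d : ℝ) ^ (n - (hi + 1)) := by
  rw [Finset.sum_boole, ← card_idxI_between hn a hlo hhi]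
  simp only [Nat.lt_succ_iff]

theorem sum_idxW_between (hd : 1 ≤ d) (ht : t < n) {w₀ : Str d (n - t)} {B : Finset (Str d n)}
    (hB : B.Nonempty) (hBw : B ⊆ windowSet t w₀) {lo hi : ℕ} (hlo : lo ≤ hi + 1)
    (hhi : hi + 1 ≤ n - t) :
    (∑ w ∈ Finset.univ.erase w₀, if lo ≤ idxW t B w ∧ idxW t B w ≤ hi then (1 : ℝ) else 0)
      = (d : ℝ) ^ (n - t - lo) - (d : ℝ) ^ (n - t - (hi + 1)) := by
  rw [Finset.sum_boole, ← card_idxW_between hd ht hB hBw hlo hhi]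
  simp only [Nat.lt_succ_iff]

theorem sum_alpha (hd : 1 ≤ d) (ht : t < n) {w₀ : Str d (n - t)} {B : Finset (Str d n)}
    (hB : B.Nonempty) (hBw : B ⊆ windowSet t w₀) {lo : ℕ} (hlo : lo ≤ n - t) :
    (∑ w ∈ Finset.univ.erase w₀,
      (d : ℝ) ^ t * if lo ≤ idxW t B w ∧ idxW t B w ≤ n - t - 1 then (1 : ℝ) else 0)
      = (d : ℝ) ^ (n - lo) - (d : ℝ) ^ t := by
  rw [← Finset.mul_sum, sum_idxW_between hd ht hB hBw (by omega) (by omega),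
    show n - t - (n - t - 1 + 1) = 0 by omega, mul_sub, ← pow_add,
    show t + (n - t - lo) = n - lo by omega]
  ring

/-- The weight `d^j - d^p` is the number of inputs `u` with `n - j ≤ i(u) ≤ n - p - 1`. Multiplied
by the number `d^(n-t-j) - d^(n-t-j-1)` of windows of index `j`, it gives a constant plus a term
that telescopes in `j`. -/
theorem sum_idxW_weighted (hd : 1 ≤ d) (ht : t < n) {w₀ : Str d (n - t)} {B : Finset (Str d n)}
    (hB : B.Nonempty) (hBw : B ⊆ windowSet t w₀) {p : ℕ} (r : ℕ) (hr : p + r + 1 ≤ n - t) :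
    (∑ w ∈ Finset.univ.erase w₀, if p + 1 ≤ idxW t B w ∧ idxW t B w ≤ p + r then
        (d : ℝ) ^ idxW t B w - (d : ℝ) ^ p else 0)
      = (r : ℝ) * ((d : ℝ) ^ (n - t) - (d : ℝ) ^ (n - t - 1)) - (d : ℝ) ^ (n - t - 1)
        + (d : ℝ) ^ (n - t - 1 - r) := by
  induction r with
  | zero =>
    rw [Finset.sum_eq_zero]
    · simp
    · intro w _
      rw [if_neg (by omega)]
  | succ r ih =>
    have hsplit : ∀ w : Str d (n - t),
        (if p + 1 ≤ idxW t B w ∧ idxW t B w ≤ p + (r + 1) then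
          (d : ℝ) ^ idxW t B w - (d : ℝ) ^ p else 0) =
        (if p + 1 ≤ idxW t B w ∧ idxW t B w ≤ p + r then
          (d : ℝ) ^ idxW t B w - (d : ℝ) ^ p else 0) +
        (if p + r + 1 ≤ idxW t B w ∧ idxW t B w ≤ p + r + 1 then (1 : ℝ) else 0) *
          ((d : ℝ) ^ (p + r + 1) - (d : ℝ) ^ p) := by
      intro w
      by_cases h : idxW t B w = p + r + 1
      · rw [if_pos (by omega), if_neg (by omega), if_pos (by omega), h]
        ring
      · rw [if_neg (c := p + r + 1 ≤ _ ∧ _) (by omega), zero_mul, add_zero]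
        exact if_congr (by omega) rfl rfl
    rw [Finset.sum_congr rfl fun w _ => hsplit w, Finset.sum_add_distrib, ih (by omega),
      ← Finset.sum_mul, sum_idxW_between hd ht hB hBw (by omega) (by omega)]
    -- Writing `n - t = p + r + s + 2` removes all truncated subtractions from the exponents.
    obtain ⟨s, hs⟩ := Nat.exists_eq_add_of_le hr
    rw [show n - t - (p + r + 1) = s + 1 by omega, show n - t - (p + r + 1 + 1) = s by omega,
      show n - t - 1 - r = p + s + 1 by omega, show n - t - 1 - (r + 1) = p + s by omega,
      show n - t - 1 = p + r + 1 + s by omega, show n - t = p + r + 1 + s + 1 by omega]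
    push_cast
    ring

theorem sum_beta (hd : 1 ≤ d) (ht : t < n) (a : Str d n) {w₀ : Str d (n - t)}
    {B : Finset (Str d n)} (hB : B.Nonempty) (hBw : B ⊆ windowSet t w₀) {p J : ℕ} (hp : p ≤ J)
    (hJ : J + 1 ≤ n - t) :
    (∑ x ∈ pairsUW t a w₀ B, if (p + 1 ≤ idxW t B x.2 ∧ idxW t B x.2 ≤ J) ∧
        (n - idxW t B x.2 ≤ idxI a x.1 ∧ idxI a x.1 ≤ n - p - 1) then (1 : ℝ) else 0)
      = ((J - p : ℕ) : ℝ) * ((d : ℝ) ^ (n - t) - (d : ℝ) ^ (n - t - 1)) - (d : ℝ) ^ (n - t - 1)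
        + (d : ℝ) ^ (n - t - 1 - (J - p)) := by
  obtain ⟨r, rfl⟩ := Nat.exists_eq_add_of_le hp
  rw [Nat.add_sub_cancel_left, ← sum_idxW_weighted hd ht hB hBw r hJ, pairsUW, Finset.sum_filter,
    Finset.sum_product_right]
  refine Finset.sum_congr rfl fun w _ => ?_
  by_cases hw : p + 1 ≤ idxW t B w ∧ idxW t B w ≤ p + r
  · rw [if_pos hw]
    have h := sum_idxI_between (by omega) a (lo := n - idxW t B w) (hi := n - p - 1)
      (by omega) (by omega)
    rw [show n - (n - idxW t B w) = idxW t B w by omega,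
      show n - (n - p - 1 + 1) = p by omega] at h
    rw [← h]
    -- The bound `n - j(w) ≤ i(u)` already contains the condition that defines `pairsUW`.
    refine Finset.sum_congr rfl fun u _ => ?_
    simp only [hw, true_and, and_self]
    rw [← ite_and]
    exact if_congr (by omega) rfl rfl
  · rw [if_neg hw]
    refine Finset.sum_eq_zero fun u _ => ?_
    rw [if_neg (c := _ ∧ _) fun h => hw h.1, ite_self]

/-- The contribution `c₁` of the windows to the cost. -/
def windowCost (d n t p : ℕ) : ℝ :=
  if n / 2 ≤ t then
    ((n - t - 1 - p : ℕ) : ℝ) * ((d : ℝ) ^ (n - t) - (d : ℝ) ^ (n - t - 1))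
      - (d : ℝ) ^ (n - t - 1) + (d : ℝ) ^ p
  else if p + 1 ≤ t then
    ((t - p : ℕ) : ℝ) * ((d : ℝ) ^ (n - t) - (d : ℝ) ^ (n - t - 1))
      + (d : ℝ) ^ (n + p - 2 * t - 1) - (d : ℝ) ^ t
  else (d : ℝ) ^ (n - p - 1) - (d : ℝ) ^ t

theorem sum_alpha_add_sum_beta (hd : 1 ≤ d) (ht : t < n) (a : Str d n) {w₀ : Str d (n - t)}
    {B : Finset (Str d n)} (hB : B.Nonempty) (hBw : B ⊆ windowSet t w₀) {p : ℕ} (q : ℕ)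
    (hp : p ≤ n - t - 1) :
    (∑ w ∈ Finset.univ.erase w₀, (d : ℝ) ^ t * (dualFamily t a B p q).α w) +
      (∑ x ∈ pairsUW t a w₀ B, (dualFamily t a B p q).β x.1 x.2) = windowCost d n t p := by
  simp only [dualFamily, windowCost]
  split_ifs with h1 h2
  · rw [sum_beta hd ht a hB hBw hp (by omega), show n - t - 1 - (n - t - 1 - p) = p by omega]
    simp
  · rw [sum_beta hd ht a hB hBw (by omega) (by omega), sum_alpha hd ht hB hBw (by omega),
      show n - t - 1 - (t - p) = n + p - 2 * t - 1 by omega,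
      show n - (t + 1) = n - t - 1 by omega]
    ring
  · rw [sum_alpha hd ht hB hBw (by omega), Finset.sum_const_zero,
      show n - (p + 1) = n - p - 1 by omega, add_zero]

theorem sum_gamma (ht : t < n) (a : Str d n) (B : Finset (Str d n)) {p q : ℕ}
    (hp : p ≤ n - t - 1) (hq : n - t ≤ q) (hqn : q ≤ n) :
    (∑ u ∈ allA a, (dualFamily t a B p q).γ u)
      = if q = n - t then 0 else (d : ℝ) ^ (q - 1) - (d : ℝ) ^ p := by
  simp only [dualFamily]
  split_ifs with h
  · simp
  · rw [sum_idxI_between (by omega) a (by omega) (by omega),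
      show n - (n - q + 1) = q - 1 by omega, show n - (n - p - 1 + 1) = p by omega]

theorem sum_epsilon (f : ℕ) (ht : t < n) (a : Str d n) (B : Finset (Str d n)) {p : ℕ} (q : ℕ)
    (hp : p ≤ n - t - 1) :
    (∑ u ∈ allA a, (f : ℝ) * (dualFamily t a B p q).ε u) = (f : ℝ) * ((d : ℝ) ^ p - 1) := by
  have h := sum_idxI_between (by omega) a (lo := n - p) (hi := n - 1) (by omega) (by omega)
  rw [show n - (n - p) = p by omega, show n - (n - 1 + 1) = 0 by omega, pow_zero] at h
  rw [← Finset.mul_sum, ← h]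
  congr 1
  refine Finset.sum_congr rfl fun u _ => ?_
  have hi : idxI a u ≤ n - 1 := suf_le _ _
  simp [dualFamily, hi]

/-! ### Windows of size `d^(n-q)` meeting `B`, and the total objective value -/

theorem window_eq_of_window_sub_eq {q : ℕ} (hq : n - t ≤ q) (hqn : q ≤ n) {v b : Str d n}
    (h : window (n - q) v = window (n - q) b) : window t v = window t b := by
  rw [window_eq_iff] at h ⊢
  exact fun i hi => h i (by omega)

/-- The outputs that agree with a member of `B` in the first `n - s` symbols. -/
theorem card_window_mem_image (hd : 1 ≤ d) {s : ℕ} (hs : s ≤ n) (B : Finset (Str d n)) :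
    (Finset.univ.filter fun v : Str d n => window s v ∈ B.image (window s)).card
      = (B.image (window s)).card * d ^ s := by
  rw [Finset.card_eq_sum_card_fiberwise (f := window s) (t := B.image (window s))
    (fun v hv => by simpa using hv)]
  rw [Finset.sum_const_nat (m := d ^ s)]
  intro c hc
  rw [← card_windowSet hd hs c]
  congr 1
  ext v
  simp only [Finset.mem_filter, Finset.mem_univ, true_and, mem_windowSet]
  constructor
  · exact fun h => h.2
  · intro h
    exact ⟨h ▸ hc, h⟩

theorem mem_biUnion_setB_iff {B : Finset (Str d n)} {q : ℕ} (hq : 1 ≤ q) (hqn : q ≤ n)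
    (v : Str d n) :
    v ∈ (Finset.Ico q n).biUnion (setB B) ↔
      v ∉ B ∧ window (n - q) v ∈ B.image (window (n - q)) := by
  simp only [Finset.mem_biUnion, Finset.mem_Ico, mem_setB, Finset.mem_image]
  constructor
  · rintro ⟨j, ⟨h1, h2⟩, hv, b, hb, rfl⟩
    refine ⟨hv, b, hb, ((window_eq_iff v b).2 fun i hi => ?_).symm⟩
    exact (le_pre_trunc_iff v b (j := q) (by omega)).1 h1 i (by omega)
  · rintro ⟨hv, b, hb, h⟩
    have h := (window_eq_iff v b).1 h.symm
    -- For `q = n` both sides are false: agreement in all symbols would put `v` in `B`.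
    have hlt : q ≤ n - 1 := by
      by_contra hlt
      refine hv ?_
      have : v = b := funext fun i => h i (by omega)
      rwa [this]
    have hle := pre_le (trunc v) (trunc b)
    exact ⟨_, ⟨(le_pre_trunc_iff v b hlt).2 fun i hi => h i (by omega), by omega⟩, hv, b, hb, rfl⟩

theorem window_mem_image_subset {w₀ : Str d (n - t)} {B : Finset (Str d n)}
    (hBw : B ⊆ windowSet t w₀) {q : ℕ} (hq : n - t ≤ q) (hqn : q ≤ n) :
    (Finset.univ.filter fun v : Str d n => window (n - q) v ∈ B.image (window (n - q)))
      ⊆ windowSet t w₀ := by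
  intro v hv
  simp only [Finset.mem_filter, Finset.mem_univ, true_and, Finset.mem_image] at hv
  obtain ⟨b, hb, h⟩ := hv
  rw [mem_windowSet, ← window_eq_of_window_sub_eq hq hqn h]
  exact mem_windowSet.1 (hBw hb)

theorem sum_delta (hd : 1 ≤ d) (ht : t < n) (a : Str d n) {w₀ : Str d (n - t)}
    {B : Finset (Str d n)} (hBw : B ⊆ windowSet t w₀) (p : ℕ) {q : ℕ} (hq : n - t ≤ q)
    (hqn : q ≤ n) :
    (∑ v ∈ windowSet t w₀ \ B, (dualFamily t a B p q).δ v)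
      = (d : ℝ) ^ (n - q) * (B.image (window (n - q))).card - B.card := by
  have hsub : B ⊆ Finset.univ.filter fun v : Str d n =>
      window (n - q) v ∈ B.image (window (n - q)) := by
    intro v hv
    simpa using ⟨v, hv, rfl⟩
  simp only [dualFamily]
  rw [Finset.sum_boole]
  have heq : ((windowSet t w₀ \ B).filter fun v => v ∈ (Finset.Ico q n).biUnion (setB B)) =
      (Finset.univ.filter fun v : Str d n => window (n - q) v ∈ B.image (window (n - q))) \ B := by
    ext v
    rw [Finset.mem_filter, mem_biUnion_setB_iff (by omega) hqn, Finset.mem_sdiff,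
      Finset.mem_sdiff, Finset.mem_filter]
    constructor
    · rintro ⟨_, h1, h2⟩
      exact ⟨⟨Finset.mem_univ _, h2⟩, h1⟩
    · rintro ⟨h1, h2⟩
      refine ⟨⟨window_mem_image_subset hBw hq hqn (Finset.mem_filter.2 h1), h2⟩, h2, h1.2⟩
  rw [heq, Finset.cast_card_sdiff hsub, card_window_mem_image hd (Nat.sub_le n q)]
  push_cast
  ring

/-- The window is the disjoint union of its subwindows of size `d^(n-q)`; compare cardinalities. -/
theorem card_image_windowSet (hd : 1 ≤ d) (ht : t < n) (w₀ : Str d (n - t)) {q : ℕ}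
    (hq : n - t ≤ q) (hqn : q ≤ n) :
    ((windowSet t w₀).image (window (n - q))).card = d ^ (q - (n - t)) := by
  have h := card_window_mem_image hd (Nat.sub_le n q) (windowSet t w₀)
  have heq : (Finset.univ.filter fun v : Str d n =>
      window (n - q) v ∈ (windowSet t w₀).image (window (n - q))) = windowSet t w₀ := by
    refine (window_mem_image_subset (Finset.Subset.refl _) hq hqn).antisymm fun v hv => ?_
    exact Finset.mem_filter.2 ⟨Finset.mem_univ _, Finset.mem_image_of_mem _ hv⟩
  rw [heq, card_windowSet hd ht.le] at h
  have hpow : d ^ t = d ^ (q - (n - t)) * d ^ (n - q) := by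
    rw [← pow_add]
    congr 1
    omega
  exact Nat.eq_of_mul_eq_mul_right (pow_pos hd (n - q)) (h.symm.trans hpow)

theorem card_image_window_le (hd : 1 ≤ d) (ht : t < n) {w₀ : Str d (n - t)}
    {B : Finset (Str d n)} (hBw : B ⊆ windowSet t w₀) {q : ℕ} (hq : n - t ≤ q) (hqn : q ≤ n) :
    (B.image (window (n - q))).card ≤ min B.card (d ^ (q - (n - t))) := by
  refine le_min Finset.card_image_le ?_
  rw [← card_image_windowSet hd ht w₀ hq hqn]
  exact Finset.card_le_card (Finset.image_subset_image hBw)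

theorem exists_subset_image_eq_and_injOn {ι κ : Type*} [DecidableEq κ] (s : Finset ι)
    (g : ι → κ) : ∃ s' ⊆ s, s'.image g = s.image g ∧ Set.InjOn g s' := by
  obtain ⟨s', hs', hbij⟩ := (Set.surjOn_image g (s : Set ι)).exists_bijOn_subset
  lift s' to Finset ι using s.finite_toSet.subset hs'
  refine ⟨s', by exact_mod_cast hs', ?_, hbij.injOn⟩
  exact_mod_cast hbij.image_eq

/-- Take a transversal `S` of the subwindows of size `d^(n-q)`. A `B` of size at most `|S|` is
chosen inside `S`, a larger one around `S`. -/
theorem exists_card_image_window_eq (hd : 1 ≤ d) (ht : t < n) (w₀ : Str d (n - t)) {k q : ℕ}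
    (hk : k ≤ d ^ t) (hq : n - t ≤ q) (hqn : q ≤ n) :
    ∃ B : Finset (Str d n), B.card = k ∧ B ⊆ windowSet t w₀ ∧
      (B.image (window (n - q))).card = min k (d ^ (q - (n - t))) := by
  obtain ⟨S, hS, himg, hinj⟩ := exists_subset_image_eq_and_injOn (windowSet t w₀) (window (n - q))
  have hcard := card_image_windowSet hd ht w₀ hq hqn
  have hScard : S.card = d ^ (q - (n - t)) := by
    rw [← hcard, ← himg, Finset.card_image_of_injOn hinj]
  rcases le_total k S.card with h | h
  · obtain ⟨B, hBS, hB⟩ := Finset.exists_subset_card_eq h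
    refine ⟨B, hB, hBS.trans hS, ?_⟩
    rw [Finset.card_image_of_injOn (hinj.mono hBS), hB, ← hScard, min_eq_left h]
  · obtain ⟨B, hSB, hBw, hB⟩ := Finset.exists_subsuperset_card_eq hS h
      (by rwa [card_windowSet hd ht.le])
    refine ⟨B, hB, hBw, ?_⟩
    have : B.image (window (n - q)) = (windowSet t w₀).image (window (n - q)) := by
      refine (Finset.image_subset_image hBw).antisymm ?_
      rw [← himg]
      exact Finset.image_subset_image hSB
    rw [this, hcard, ← hScard, min_eq_right h]

theorem dualObjective_dualFamily (f : ℕ) (hd : 1 ≤ d) (ht : t < n) (a : Str d n)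
    {w₀ : Str d (n - t)} {B : Finset (Str d n)} (hB : B.Nonempty) (hBw : B ⊆ windowSet t w₀)
    {p q : ℕ} (hp : p ≤ n - t - 1) (hq : n - t ≤ q) (hqn : q ≤ n) :
    dualObjective f a w₀ B (dualFamily t a B p q) =
      windowCost d n t p + (if q = n - t then 0 else (d : ℝ) ^ (q - 1) - (d : ℝ) ^ p)
        + ((d : ℝ) ^ (n - q) * (B.image (window (n - q))).card - B.card)
        + (f : ℝ) * ((d : ℝ) ^ p - 1) := by
  rw [dualObjective, sum_alpha_add_sum_beta hd ht a hB hBw q hp, sum_gamma ht a B hp hq hqn,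
    sum_delta hd ht a hBw p hq hqn, sum_epsilon f ht a B q hp]

theorem cost_eq (f : ℕ) (hd : 1 ≤ d) (ht : t < n) {k p q : ℕ} (hk : 1 ≤ k)
    (hq : n - t ≤ q) (hqn : q ≤ n) :
    (cost d n t f k p q : ℝ) =
      windowCost d n t p + (if q = n - t then 0 else (d : ℝ) ^ (q - 1) - (d : ℝ) ^ p)
        + ((d : ℝ) ^ (n - q) * (min k (d ^ (q - (n - t))) : ℕ) - k)
        + (f : ℝ) * ((d : ℝ) ^ p - 1) := by
  have hpow : (d : ℝ) ^ t = (d : ℝ) ^ (n - q) * (d : ℝ) ^ (q - (n - t)) := by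
    rw [← pow_add]
    congr 1
    omega
  have hmin : min ((d : ℝ) ^ t - k) (k * ((d : ℝ) ^ (n - q) - 1)) =
      (d : ℝ) ^ (n - q) * (min k (d ^ (q - (n - t))) : ℕ) - k := by
    rw [Nat.cast_min, mul_min_of_nonneg _ _ (by positivity), min_comm, ← min_sub_sub_right]
    push_cast
    rw [← hpow]
    congr 1
    ring
  -- For `q = n - t` there is one subwindow, the window itself, so the same formula yields `d^t -
  -- k`.
  by_cases h : q = n - t
  · subst h
    have h1 : min k (d ^ (n - t - (n - t))) = 1 := by
      rw [Nat.sub_self, pow_zero]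
      exact min_eq_right hk
    rw [h1, Nat.sub_sub_self ht.le]
    simp only [cost, windowCost, if_true]
    split_ifs <;> push_cast <;> ring
  · rw [← hmin]
    simp only [cost, windowCost, h, if_false]
    split_ifs <;> push_cast <;> ring

/-! ### Feasibility of the family -/

/-- If `i(u) ≥ n - p`, then `ε` covers the constraint. Otherwise `i + j ≥ n` gives `j ≥ p + 1`, and
with `j(w) ≤ n - t - 1` the index falls in the range of `α` or `β`. For an output of `w₀`, `δ`
covers `j(v) ≥ q`, and `j(v) < q` gives `i(u) ≥ n - q + 1`, the range of `γ`. -/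
theorem dualFeasible_dualFamily (hd : 1 ≤ d) (ht : t < n) (a : Str d n) {w₀ : Str d (n - t)}
    {B : Finset (Str d n)} (hB : B.Nonempty) (hBw : B ⊆ windowSet t w₀) {p q : ℕ} :
    DualFeasible a w₀ B (dualFamily t a B p q) := by
  have hα : ∀ w, 0 ≤ (dualFamily t a B p q).α w := fun w => by
    simp only [dualFamily]; split_ifs <;> norm_num
  have hβ : ∀ u w, 0 ≤ (dualFamily t a B p q).β u w := fun u w => by
    simp only [dualFamily]; split_ifs <;> norm_num
  have hγ : ∀ u, 0 ≤ (dualFamily t a B p q).γ u := fun u => by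
    simp only [dualFamily]; split_ifs <;> norm_num
  have hδ : ∀ v, 0 ≤ (dualFamily t a B p q).δ v := fun v => by
    simp only [dualFamily]; split_ifs <;> norm_num
  have hε : ∀ u, 0 ≤ (dualFamily t a B p q).ε u := fun u => by
    simp only [dualFamily]; split_ifs <;> norm_num
  refine ⟨?_, ?_, fun w _ => hα w, fun x _ => hβ _ _, fun u _ => hγ u, fun v _ => hδ v,
    fun u _ => hε u⟩
  · rintro ⟨u, w⟩ hx
    simp only [pairsUW, Finset.mem_filter, Finset.mem_product, Finset.mem_erase,
      Finset.mem_univ, and_true] at hx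
    obtain ⟨⟨_, hw⟩, hij⟩ := hx
    have hj := idxW_lt hd ht hB hBw hw
    by_cases hi : n - p ≤ idxI a u
    · have : (dualFamily t a B p q).ε u = 1 := if_pos hi
      linarith [hα w, hβ u w]
    · suffices h : (dualFamily t a B p q).α w = 1 ∨ (dualFamily t a B p q).β u w = 1 by
        rcases h with h | h <;> linarith [hα w, hβ u w, hε u]
      simp only [dualFamily]
      by_cases h1 : n / 2 ≤ t
      · right
        rw [if_pos h1, if_pos (by omega)]
      · by_cases h2 : p + 1 ≤ t
        · simp only [if_neg h1, if_pos h2]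
          by_cases h3 : idxW t B w ≤ t
          · right
            rw [if_pos (by omega)]
          · left
            rw [if_pos (by omega)]
        · left
          simp only [if_neg h1, if_neg h2]
          rw [if_pos (by omega)]
  · rintro ⟨u, v⟩ hx
    simp only [pairsUV, Finset.mem_filter, Finset.mem_product] at hx
    obtain ⟨⟨_, hv⟩, hij⟩ := hx
    have hj := sub_le_idxV hB hBw hv
    have hmem := mem_setB_idxV hB (Finset.mem_sdiff.1 hv).2
    have hlt : idxV B v ≤ n - 1 := Nat.findGreatest_le _
    by_cases hi : n - p ≤ idxI a u
    · have : (dualFamily t a B p q).ε u = 1 := if_pos hi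
      linarith [hγ u, hδ v]
    · by_cases hjq : q ≤ idxV B v
      · have : (dualFamily t a B p q).δ v = 1 := by
          simp only [dualFamily]
          rw [if_pos]
          exact Finset.mem_biUnion.2 ⟨_, Finset.mem_Ico.2 ⟨hjq, by omega⟩, hmem⟩
        linarith [hγ u, hε u]
      · have : (dualFamily t a B p q).γ u = 1 := by
          simp only [dualFamily]
          -- The case `q = n - t` is excluded because `n - t ≤ j(v) < q`.
          rw [if_neg (by omega), if_pos (by omega)]
        linarith [hδ v, hε u]

/-! ### Weak duality: the planes that block a subrequest -/

theorem SharesLink.le_add {x y u v : Str d n} (h : SharesLink x y u v) :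
    n ≤ suf (trunc x) (trunc u) + pre (trunc y) (trunc v) := by
  obtain ⟨j, j', h⟩ := h
  simp only [routeLink, Prod.mk.injEq] at h
  obtain ⟨rfl, h1, h2⟩ := h
  have hs : n - 1 - j.val ≤ suf (trunc x) (trunc u) := by
    rw [le_suf_iff _ _ (Nat.sub_le _ _)]
    intro i hi
    have h := congrFun h1 i
    simp only [node] at h
    rwa [if_neg (by omega), if_neg (by omega)] at h
  have hp : j.val + 1 ≤ pre (trunc y) (trunc v) := by
    rw [le_pre_iff _ _ (by omega)]
    intro i hi
    have h := congrFun h2 i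
    simp only [node] at h
    rwa [if_pos hi, if_pos hi] at h
  omega

/-- Used with `T` a set of planes and `h` a dual variable: the fibre bound is the primal constraint
whose right-hand side `c` is the objective coefficient of `h`. -/
theorem sum_comp_le_of_card_fiber_le {ι κ : Type*} [DecidableEq κ] {T : Finset ι} {S : Finset κ}
    {g : ι → κ} (hg : ∀ i ∈ T, g i ∈ S) {c : ℕ}
    (hc : ∀ k ∈ S, (T.filter fun i => g i = k).card ≤ c) {h : κ → ℝ} (hh : ∀ k ∈ S, 0 ≤ h k) :
    ∑ i ∈ T, h (g i) ≤ ∑ k ∈ S, (c : ℝ) * h k := by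
  rw [← Finset.sum_fiberwise_of_maps_to hg]
  refine Finset.sum_le_sum fun k hk => ?_
  rw [Finset.sum_congr rfl fun i hi => congrArg h (Finset.mem_filter.1 hi).2, Finset.sum_const,
    nsmul_eq_mul]
  exact mul_le_mul_of_nonneg_right (by exact_mod_cast hc k hk) (hh k hk)

theorem sum_comp_le_of_injOn {ι κ : Type*} [DecidableEq κ] {T : Finset ι} {S : Finset κ}
    {g : ι → κ} (hg : ∀ i ∈ T, g i ∈ S) (hinj : Set.InjOn g T) {h : κ → ℝ}
    (hh : ∀ k ∈ S, 0 ≤ h k) : ∑ i ∈ T, h (g i) ≤ ∑ k ∈ S, h k := by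
  have := sum_comp_le_of_card_fiber_le hg (c := 1) (fun k _ => Finset.card_le_one.2 ?_) hh
  · simpa using this
  · intro i hi j hj
    rw [Finset.mem_filter] at hi hj
    exact hinj hi.1 hj.1 (hi.2.trans hj.2.symm)

/-- Weak duality: a set `T` of planes, each carrying a route `R(u P, v P)` that shares a link with
some route of the request, is no larger than the objective value of any dual feasible solution. -/
theorem card_le_dualObjective {m f : ℕ} (hd : 1 ≤ d) (ht : t < n) {a : Str d n}
    {w₀ : Str d (n - t)} {B : Finset (Str d n)} (hB : B.Nonempty) (hBw : B ⊆ windowSet t w₀)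
    {y : DualVars d n t} (hy : DualFeasible a w₀ B y) (T : Finset (Fin m))
    (u v : Fin m → Str d n) (hu : ∀ P ∈ T, u P ≠ a) (hv : ∀ P ∈ T, v P ∉ B)
    (hlink : ∀ P ∈ T, ∃ b ∈ B, SharesLink (u P) (v P) a b)
    (hinj : Set.InjOn v T)
    (hwin : ∀ P ∈ T, ∀ Q ∈ T, u P = u Q → window t (v P) = window t (v Q) → P = Q)
    (hf : ∀ x, (T.filter fun P => u P = x).card ≤ f) :
    (T.card : ℝ) ≤ dualObjective f a w₀ B y := by
  classical
  set T₁ := T.filter fun P => window t (v P) ≠ w₀ with hT₁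
  set T₂ := T.filter fun P => ¬ window t (v P) ≠ w₀ with hT₂
  have hsub₁ : T₁ ⊆ T := Finset.filter_subset _ _
  have hsub₂ : T₂ ⊆ T := Finset.filter_subset _ _
  have hne : ∀ P ∈ T₁, window t (v P) ≠ w₀ := fun P hP => (Finset.mem_filter.1 hP).2
  have heq : ∀ P ∈ T₂, window t (v P) = w₀ := fun P hP => not_not.1 (Finset.mem_filter.1 hP).2
  have hA : ∀ P ∈ T, u P ∈ allA a := fun P hP => (mem_allA (by omega)).2 (hu P hP)
  have hUW : ∀ P ∈ T₁, (u P, window t (v P)) ∈ pairsUW t a w₀ B := by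
    intro P hP
    obtain ⟨b, hb, h⟩ := hlink P (hsub₁ hP)
    have hb' := mem_windowSet.1 (hBw hb)
    refine Finset.mem_filter.2 ⟨Finset.mem_product.2 ⟨hA P (hsub₁ hP),
      Finset.mem_erase.2 ⟨hne P hP, Finset.mem_univ _⟩⟩, ?_⟩
    have h2 := pre_trunc_eq_pre_window ht (v := v P) (b := b) (by rw [hb']; exact hne P hP)
    rw [idxW_eq hd ht hB hBw (hne P hP), ← hb', ← h2]
    exact h.le_add
  have hV : ∀ P ∈ T₂, v P ∈ windowSet t w₀ \ B := fun P hP =>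
    Finset.mem_sdiff.2 ⟨mem_windowSet.2 (heq P hP), hv P (hsub₂ hP)⟩
  have hUV : ∀ P ∈ T₂, (u P, v P) ∈ pairsUV t a w₀ B := by
    intro P hP
    obtain ⟨b, hb, h⟩ := hlink P (hsub₂ hP)
    refine Finset.mem_filter.2 ⟨Finset.mem_product.2 ⟨hA P (hsub₂ hP), hV P hP⟩, ?_⟩
    exact h.le_add.trans (Nat.add_le_add_left (pre_trunc_le_idxV (hv P (hsub₂ hP)) hb) _)
  have hα : ∑ P ∈ T₁, y.α (window t (v P)) ≤ ∑ w ∈ Finset.univ.erase w₀, (d : ℝ) ^ t * y.α w := by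
    have := sum_comp_le_of_card_fiber_le (T := T₁) (S := Finset.univ.erase w₀)
      (g := fun P => window t (v P)) (c := d ^ t) (h := y.α)
      (fun P hP => Finset.mem_erase.2 ⟨hne P hP, Finset.mem_univ _⟩) ?_
      fun w hw => hy.α_nonneg w (Finset.ne_of_mem_erase hw)
    · simpa using this
    · intro w _
      -- Distinct planes use distinct outputs, and a window has only `d^t` of them.
      rw [← card_windowSet hd ht.le w]
      refine Finset.card_le_card_of_injOn v ?_ ?_
      · intro P hP
        exact mem_windowSet.2 (Finset.mem_filter.1 hP).2
      · exact hinj.mono fun P hP => hsub₁ (Finset.mem_filter.1 hP).1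
  have hβ : ∑ P ∈ T₁, y.β (u P) (window t (v P)) ≤ ∑ x ∈ pairsUW t a w₀ B, y.β x.1 x.2 := by
    refine sum_comp_le_of_injOn (g := fun P => (u P, window t (v P)))
      (h := fun x => y.β x.1 x.2) hUW ?_ hy.β_nonneg
    intro P hP Q hQ h
    exact hwin P (hsub₁ hP) Q (hsub₁ hQ) (congrArg Prod.fst h) (congrArg Prod.snd h)
  have hγ : ∑ P ∈ T₂, y.γ (u P) ≤ ∑ x ∈ allA a, y.γ x := by
    refine sum_comp_le_of_injOn (fun P hP => hA P (hsub₂ hP)) ?_ hy.γ_nonneg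
    intro P hP Q hQ h
    -- All outputs of `T₂` lie in `w₀`, so an input occurs at most once there.
    exact hwin P (hsub₂ hP) Q (hsub₂ hQ) h ((heq P hP).trans (heq Q hQ).symm)
  have hδ : ∑ P ∈ T₂, y.δ (v P) ≤ ∑ x ∈ windowSet t w₀ \ B, y.δ x :=
    sum_comp_le_of_injOn hV (hinj.mono hsub₂) hy.δ_nonneg
  have hε : ∑ P ∈ T, y.ε (u P) ≤ ∑ x ∈ allA a, (f : ℝ) * y.ε x :=
    sum_comp_le_of_card_fiber_le hA (fun x _ => hf x) hy.ε_nonneg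
  -- Each plane pays for itself through the dual constraint of its own route.
  have h₁ : (T₁.card : ℝ) ≤
      ∑ P ∈ T₁, (y.α (window t (v P)) + y.β (u P) (window t (v P)) + y.ε (u P)) := by
    rw [← nsmul_one, ← Finset.sum_const]
    exact Finset.sum_le_sum fun P hP => hy.dc1 _ (hUW P hP)
  have h₂ : (T₂.card : ℝ) ≤ ∑ P ∈ T₂, (y.γ (u P) + y.δ (v P) + y.ε (u P)) := by
    rw [← nsmul_one, ← Finset.sum_const]
    exact Finset.sum_le_sum fun P hP => hy.dc2 _ (hUV P hP)
  have hcard : (T.card : ℝ) = T₁.card + T₂.card := by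
    exact_mod_cast (Finset.card_filter_add_card_filter_not (s := T) _).symm
  have hsplit : ∑ P ∈ T, y.ε (u P) = ∑ P ∈ T₁, y.ε (u P) + ∑ P ∈ T₂, y.ε (u P) :=
    (Finset.sum_filter_add_sum_filter_not T _ _).symm
  simp only [Finset.sum_add_distrib] at h₁ h₂
  rw [dualObjective]
  linarith

/-! ### Reachable states -/

/-- The properties of a reachable state that the planes bound depends on. -/
structure StateInvariant {m : ℕ} (f t : ℕ) (s : State d n m) : Prop where
  card_le : ∀ u c, s u = some c → c.dests.card ≤ f
  followsWindowRule : ∀ u c, s u = some c → FollowsWindowRule t c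
  disjoint : ∀ u c u' c', s u = some c → s u' = some c' → u ≠ u' → Disjoint c.dests c'.dests

theorem Reachable.stateInvariant {m f : ℕ} {s : State d n m} (h : Reachable f t s) :
    StateInvariant f t s := by
  induction h with
  | idle => constructor <;> simp
  | connect s a c _ hreq hrule _ ih =>
    refine ⟨?_, ?_, ?_⟩
    · intro u c' hu
      rw [Function.update_apply] at hu
      split_ifs at hu with hua
      · cases hu
        exact hreq.2.1
      · exact ih.card_le u c' hu
    · intro u c' hu
      rw [Function.update_apply] at hu
      split_ifs at hu with hua
      · cases hu
        exact hrule
      · exact ih.followsWindowRule u c' hu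
    · intro u c₁ u' c₂ hu hu' hne
      rw [Function.update_apply] at hu hu'
      split_ifs at hu hu' with h1 h2 h2
      · exact absurd (h1.trans h2.symm) hne
      · cases hu
        exact (hreq.2.2 u' c₂ hu').symm
      · cases hu'
        exact hreq.2.2 u c₁ hu
      · exact ih.disjoint u c₁ u' c₂ hu hu' hne
  | release s a _ ih =>
    have hof : ∀ u c, Function.update s a none u = some c → s u = some c := by
      intro u c hu
      rw [Function.update_apply] at hu
      split_ifs at hu
      exact hu
    exact ⟨fun u c hu => ih.card_le u c (hof u c hu),
      fun u c hu => ih.followsWindowRule u c (hof u c hu),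
      fun u c u' c' hu hu' => ih.disjoint u c u' c' (hof u c hu) (hof u' c' hu')⟩

/-- Plane `P` carries a route that shares a link with a route from `a` to a member of `B`. -/
def Blocks {m : ℕ} (s : State d n m) (a : Str d n) (B : Finset (Str d n)) (P : Fin m) : Prop :=
  ∃ u c, s u = some c ∧ ∃ v ∈ c.dests, c.plane v = P ∧ ∃ b ∈ B, SharesLink u v a b

theorem exists_not_blocks {m f : ℕ} (hd : 1 ≤ d) (ht : t < n) {s : State d n m}
    (hs : StateInvariant f t s) {a : Str d n} (ha : s a = none) {w₀ : Str d (n - t)}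
    {B : Finset (Str d n)} (hB : B.Nonempty) (hBw : B ⊆ windowSet t w₀)
    (hfree : ∀ u c, s u = some c → Disjoint c.dests B) {y : DualVars d n t}
    (hy : DualFeasible a w₀ B y) (hm : dualObjective f a w₀ B y < m) :
    ∃ P : Fin m, ¬ Blocks s a B P := by
  by_contra! hall
  choose u c hsu v hvc hvP hlink using hall
  have hc : ∀ P Q, u P = u Q → c P = c Q := by
    intro P Q h
    have := hsu P
    rw [h, hsu Q] at this
    exact (Option.some_injective _ this).symm
  -- An output belongs to at most one connection, which reaches it on one plane.
  have hinj : Function.Injective v := by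
    intro P Q h
    have huPQ : u P = u Q := by
      by_contra hne
      refine Finset.disjoint_left.1 (hs.disjoint _ _ _ _ (hsu P) (hsu Q) hne) (hvc P) ?_
      rw [h]
      exact hvc Q
    rw [← hvP P, ← hvP Q, hc P Q huPQ, h]
  have hle := card_le_dualObjective (f := f) hd ht hB hBw hy Finset.univ u v ?_ ?_
    (fun P _ => hlink P) hinj.injOn ?_ ?_
  · rw [Finset.card_univ, Fintype.card_fin] at hle
    exact absurd hle (not_le.2 hm)
  · intro P _ h
    have := hsu P
    rw [h, ha] at this
    cases this
  · exact fun P _ => Finset.disjoint_left.1 (hfree _ _ (hsu P)) (hvc P)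
  · intro P _ Q _ h hw
    have := hs.followsWindowRule _ _ (hsu P) (v P) (hvc P) (v Q) (by rw [hc P Q h]; exact hvc Q) hw
    rw [← hvP P, this, hc P Q h, hvP Q]
  -- The planes charged to `x` inject, via `v`, into the at most `f` outputs of its connection.
  · intro x
    rcases Finset.eq_empty_or_nonempty (Finset.univ.filter fun P => u P = x) with h | ⟨Q, hQ⟩
    · simp [h]
    · refine le_trans ?_ (hs.card_le _ _ (hsu Q))
      refine Finset.card_le_card_of_injOn v ?_ hinj.injOn
      intro P hP
      rw [← hc P Q ((Finset.mem_filter.1 hP).2.trans (Finset.mem_filter.1 hQ).2.symm)]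
      exact hvc P

/-! ### The main result -/

theorem dualObjective_le_cost (f : ℕ) (hd : 1 ≤ d) (ht : t < n) (a : Str d n)
    {w₀ : Str d (n - t)} {B : Finset (Str d n)} (hB : B.Nonempty) (hBw : B ⊆ windowSet t w₀)
    {p q : ℕ} (hp : p ≤ n - t - 1) (hq : n - t ≤ q) (hqn : q ≤ n) :
    dualObjective f a w₀ B (dualFamily t a B p q) ≤ (cost d n t f B.card p q : ℝ) := by
  rw [dualObjective_dualFamily f hd ht a hB hBw hp hq hqn,
    cost_eq f hd ht (Finset.card_pos.2 hB) hq hqn]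
  gcongr
  exact card_image_window_le hd ht hBw hq hqn

theorem dualObjective_eq_cost (f : ℕ) (hd : 1 ≤ d) (ht : t < n) (a : Str d n)
    {w₀ : Str d (n - t)} {B : Finset (Str d n)} (hB : B.Nonempty) (hBw : B ⊆ windowSet t w₀)
    {p q : ℕ} (hp : p ≤ n - t - 1) (hq : n - t ≤ q) (hqn : q ≤ n)
    (himg : (B.image (window (n - q))).card = min B.card (d ^ (q - (n - t)))) :
    dualObjective f a w₀ B (dualFamily t a B p q) = (cost d n t f B.card p q : ℝ) := by
  rw [dualObjective_dualFamily f hd ht a hB hBw hp hq hqn,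
    cost_eq f hd ht (Finset.card_pos.2 hB) hq hqn, himg]

/-- At `q = n - t` the nonempty `B` meets exactly one window, whatever its shape; hence equality for
every `B`. -/
theorem card_image_window_self (hd : 1 ≤ d) (ht : t < n) {w₀ : Str d (n - t)}
    {B : Finset (Str d n)} (hB : B.Nonempty) (hBw : B ⊆ windowSet t w₀) :
    (B.image (window (n - (n - t)))).card = min B.card (d ^ (n - t - (n - t))) := by
  refine le_antisymm (card_image_window_le hd ht hBw le_rfl (Nat.sub_le n t)) ?_
  rw [Nat.sub_self, pow_zero]
  exact (min_le_right _ _).trans (Finset.card_pos.2 (hB.image _))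

theorem wideSenseNonblocking_of_le {f m : ℕ} (hd : 1 ≤ d) (ht : t < n) (hf : 1 ≤ f)
    (hm : 1 + maxMinCost d n t f hd hf ≤ (m : ℤ)) : WideSenseNonblocking d n m f t := by
  have hfree : ∀ s : State d n m, Reachable f t s → ∀ a B, IsRequest f s a B → B.Nonempty →
      ∀ w₀ : Str d (n - t), B ⊆ windowSet t w₀ → ∃ P : Fin m, ¬ Blocks s a B P := by
    intro s hs a B hreq hB w₀ hBw
    have hcard : B.card ≤ d ^ t := by
      rw [← card_windowSet hd ht.le w₀]
      exact Finset.card_le_card hBw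
    have hmax : minCost d n t f B.card ≤ maxMinCost d n t f hd hf :=
      Finset.le_sup' (minCost d n t f)
        (Finset.mem_Icc.2 ⟨Finset.card_pos.2 hB, le_min hreq.2.1 hcard⟩)
    obtain ⟨⟨p, q⟩, hpq, hmin⟩ := Finset.exists_mem_eq_inf'
      (Finset.Nonempty.product (Finset.nonempty_Icc.2 (Nat.zero_le (n - t - 1)))
        (Finset.nonempty_Icc.2 (Nat.sub_le n t)))
      fun x : ℕ × ℕ => cost d n t f B.card x.1 x.2
    rw [Finset.mem_product, Finset.mem_Icc, Finset.mem_Icc] at hpq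
    refine exists_not_blocks hd ht hs.stateInvariant hreq.1 hB hBw hreq.2.2
      (dualFeasible_dualFamily (p := p) (q := q) hd ht a hB hBw) ?_
    refine (dualObjective_le_cost f hd ht a hB hBw hpq.1.2 hpq.2.1 hpq.2.2).trans_lt ?_
    have : cost d n t f B.card p q < (m : ℤ) := by
      have hval : minCost d n t f B.card = cost d n t f B.card p q := hmin
      omega
    exact_mod_cast this
  intro s hs a B hreq
  have hsub : ∀ B' ⊆ B, IsRequest f s a B' := fun B' h =>
    ⟨hreq.1, (Finset.card_le_card h).trans hreq.2.1,
      fun u c hu => (hreq.2.2 u c hu).mono_right h⟩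
  have hplane : ∀ w : Str d (n - t), ∃ P : Fin m,
      ¬ Blocks s a (B.filter fun b => window t b = w) P := by
    intro w
    rcases Finset.eq_empty_or_nonempty (B.filter fun b => window t b = w) with h | h
    -- For a window without requested outputs any plane will do, but one must exist; a unicast
    -- request in the idle network, with the string `a` also as output, supplies it.
    · obtain ⟨P, _⟩ := hfree (fun _ => none) Reachable.idle a {a}
        ⟨rfl, by simpa using hf, by simp⟩ (Finset.singleton_nonempty a) (window t a)
        (by simp [windowSet])
      refine ⟨P, ?_⟩
      rw [h]
      rintro ⟨_, _, _, _, _, _, b, hb, _⟩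
      simp at hb
    · exact hfree s hs a _ (hsub _ (Finset.filter_subset _ _)) h w
        fun b hb => mem_windowSet.2 (Finset.mem_filter.1 hb).2
  choose P hP using hplane
  -- Choosing the plane by the window alone makes the window rule automatic.
  refine ⟨⟨B, fun b => P (window t b)⟩, rfl, ?_, ?_⟩
  · intro b _ b' _ h
    exact congrArg P h
  · intro u c hu v hv b hb hvb hshare
    exact hP (window t b) ⟨u, c, hu, v, hv, hvb, b, Finset.mem_filter.2 ⟨hb, rfl⟩, hshare⟩

end Multilog

open Multilog in
theorem mainTheorem3 (d n t f : ℕ) (hd : 1 ≤ d) (ht : t < n) (hf : 1 ≤ f) (hfN : f ≤ d ^ n) :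
    -- each member of the family is dual feasible, with objective value at most `c(k, p, q)`,
    -- and equal to it if `q = n - t`
    (∀ (a : Str d n) (w₀ : Str d (n - t)) (B : Finset (Str d n)),
      B.Nonempty → B.card ≤ f → B ⊆ windowSet t w₀ →
      ∀ p q : ℕ, p ≤ n - t - 1 → n - t ≤ q → q ≤ n →
        DualFeasible a w₀ B (dualFamily t a B p q) ∧
        dualObjective f a w₀ B (dualFamily t a B p q) ≤ (cost d n t f B.card p q : ℝ) ∧
        (q = n - t →
          dualObjective f a w₀ B (dualFamily t a B p q) = (cost d n t f B.card p q : ℝ))) ∧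
    -- for every `k` and `q`, the value `c(k, p, q)` is attained by a suitable request
    (∀ (a : Str d n) (w₀ : Str d (n - t)) (k q : ℕ),
      1 ≤ k → k ≤ min f (d ^ t) → n - t ≤ q → q ≤ n →
      ∃ B : Finset (Str d n), B.card = k ∧ B ⊆ windowSet t w₀ ∧ ∀ p : ℕ, p ≤ n - t - 1 →
        dualObjective f a w₀ B (dualFamily t a B p q) = (cost d n t f k p q : ℝ)) ∧
    -- the sufficient condition
    (∀ m : ℕ, 1 + maxMinCost d n t f hd hf ≤ (m : ℤ) → WideSenseNonblocking d n m f t) := by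
  refine ⟨?_, ?_, fun m hm => wideSenseNonblocking_of_le hd ht hf hm⟩
  · intro a w₀ B hB _ hBw p q hp hq hqn
    refine ⟨dualFeasible_dualFamily hd ht a hB hBw,
      dualObjective_le_cost f hd ht a hB hBw hp hq hqn, ?_⟩
    rintro rfl
    exact dualObjective_eq_cost f hd ht a hB hBw hp hq hqn (card_image_window_self hd ht hB hBw)
  · intro a w₀ k q hk hkf hq hqn
    obtain ⟨B, rfl, hBw, himg⟩ :=
      exists_card_image_window_eq hd ht w₀ (hkf.trans (min_le_right _ _)) hq hqn
    exact ⟨B, rfl, hBw, fun p hp =>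
      dualObjective_eq_cost f hd ht a (Finset.card_pos.1 hk) hBw hp hq hqn himg⟩
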